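/- For a sequence $(a_n)_{n\ge1}$ of positive integers write $[0;a_1,a_2,\dots]=\lim_{n\to\infty}[0;a_1,\dots,a_n]$, where $[0;a_1,\dots,a_n]=\cfrac{1}{a_1+\cfrac{1}{a_2+\cfrac{1}{\cdots+\cfrac{1}{a_n}}}}$, and let $$E_4=\bigl\{[0;a_1,a_2,\dots] : a_n\in\{1,2,3,4\}\text{ for all } n\ge 1\bigr\}\subset[0,1].$$ Then the Hausdorff dimension of $E_4$ satisfies $\dim_H(E_4)=0.788945557483\pm10^{-12}$, that is, $$0.788945557483-10^{-12}\;\le\;\dim_H(E_4)\;\le\;0.788945557483+10^{-12}.$$ In particular $\dim_H(E_4)>\dfrac{\sqrt{19}-2}{3}$. -/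

import Mathlib

open Filter Topology

/-- The infinite continued fraction expression `[0; a 0, a 1, a 2, …]`, that is
`1 / (a 0 + 1 / (a 1 + 1 / (a 2 + ⋯)))`, over the reals. -/
def digitContFract (a : ℕ → ℕ) : GenContFract ℝ where
  h := 0
  s := ⟨fun n => some ⟨1, (a n : ℝ)⟩, fun {_} h => by simp at h⟩

/-- `x = [0; a 0, a 1, …]`: the finite continued fractions `[0; a 0, …, a (n - 1)]`
(evaluated as nested fractions) converge to `x`. -/
def IsContFractValue (a : ℕ → ℕ) (x : ℝ) : Prop :=
  Tendsto (fun n => (digitContFract a).convs' n) atTop (𝓝 x)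

/-- `E m`: the reals `[0; a 0, a 1, a 2, …]` given by infinite continued fractions all of whose
digits lie in `{1, 2, …, m}`. -/
def contFractSet (m : ℕ) : Set ℝ :=
  {x | ∃ a : ℕ → ℕ, (∀ n, a n ∈ Finset.Icc 1 m) ∧ IsContFractValue a x}

/-!
Let `φᵢ x = 1 / (i + x)` be the branch attached to the digit `i`. The cylinders of continued
fractions with a given initial word have bounded distortion, so the sums of the `s`-th powers of
their sizes are comparable to the iterates of the transfer operator
`L_s f = ∑ᵢ |φᵢ'| ^ s • f ∘ φᵢ`. A positive `f` with `L_s f ≤ f` keeps these sums bounded, hence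
the dimension is at most `s`; if `f ≤ L_s f` they do not decay, and comparing any cover with a
finite cover by cylinders bounds the dimension below by `s`. Since `L_{s + δ}` is smaller than
`L_s` by at least a factor `1 + O(δ)`, an approximate eigenfunction with eigenvalue near `1`
suffices for both bounds.

The approximate eigenfunction is a polynomial in `h = x - 1 / 2`. The weights `(i + x) ^ (-2s)` are
replaced by polynomials `p`, of which it is checked in rational arithmetic that they nearly solve
`(c + h) p' + 2s p = 0`. Then `p` divided by the weight is nearly constant on each interval
`|h| ≤ 1 / 2`, and the intervals of consecutive digits abut, so all these quotients are close to
the one at `i + x = 1`, where the weight is `1`.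
-/

open scoped MeasureTheory

section SymbolicCoding

variable {ι : Type*}

/-- The word formed by the first `n` letters of a sequence. -/
def prefixWord (a : ℕ → ι) (n : ℕ) : List ι := List.ofFn fun k : Fin n => a k

@[simp]
theorem length_prefixWord (a : ℕ → ι) (n : ℕ) : (prefixWord a n).length = n := List.length_ofFn

theorem prefixWord_succ (a : ℕ → ι) (n : ℕ) :
    prefixWord a (n + 1) = a 0 :: prefixWord (fun k => a (k + 1)) n := by
  simp [prefixWord, List.ofFn_succ]

theorem prefixWord_add (a : ℕ → ι) (m n : ℕ) :
    prefixWord a (m + n) = prefixWord a m ++ prefixWord (fun k => a (m + k)) n := by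
  simp [prefixWord, List.ofFn_add]

theorem prefixWord_eq_prefixWord {a b : ℕ → ι} {n : ℕ} :
    prefixWord a n = prefixWord b n ↔ ∀ k < n, a k = b k := by
  simp only [prefixWord, List.ofFn_inj, funext_iff, Fin.forall_iff]

theorem exists_prefixWord_eq_ofFn [Nonempty ι] {n : ℕ} (u : Fin n → ι) :
    ∃ a : ℕ → ι, prefixWord a n = List.ofFn u := by
  refine ⟨fun k => if h : k < n then u ⟨k, h⟩ else Classical.arbitrary ι, ?_⟩
  simp [prefixWord]

theorem isOpen_setOf_prefixWord_eq [TopologicalSpace ι] [DiscreteTopology ι] (w : List ι) :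
    IsOpen {a : ℕ → ι | prefixWord a w.length = w} := by
  rcases Set.eq_empty_or_nonempty {a : ℕ → ι | prefixWord a w.length = w} with h | ⟨a, ha⟩
  · rw [h]; exact isOpen_empty
  · convert PiNat.isOpen_cylinder (fun _ => ι) a w.length using 1
    ext b
    rw [PiNat.mem_cylinder_iff, ← prefixWord_eq_prefixWord, show prefixWord a w.length = w from ha,
      Set.mem_ofPred_eq]

/-- The partition sum `∑ r(w) ^ s` over the words `w` of length `n`, where `r` assigns to each word
the size of its cylinder. -/
noncomputable def partitionSum [Fintype ι] (r : List ι → ℝ) (s : ℝ) (n : ℕ) : ℝ :=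
  ∑ w : Fin n → ι, r (List.ofFn w) ^ s

variable {r : List ι → ℝ} {s : ℝ}

theorem partitionSum_le_sum_of_cover [Fintype ι] [Nonempty ι] {D : ℝ} (hr : ∀ w, 0 ≤ r w)
    (hD : 0 ≤ D) (hmul : ∀ u v, r (u ++ v) ≤ D * r u * r v) (hs : 0 ≤ s) {κ : Type*}
    {I : Finset κ} {w : κ → List ι} (hcov : ∀ a : ℕ → ι, ∃ i ∈ I, prefixWord a (w i).length = w i)
    {N : ℕ} (hN : ∀ i ∈ I, (w i).length ≤ N) :
    partitionSum r s N ≤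
      D ^ s * ∑ i ∈ I, r (w i) ^ s * partitionSum r s (N - (w i).length) := by
  classical
  choose a ha using fun u : Fin N → ι => exists_prefixWord_eq_ofFn u
  choose i hiI hi using fun u => hcov (a u)
  set tail : ∀ u, Fin (N - (w (i u)).length) → ι := fun u k => a u ((w (i u)).length + k)
  have hsplit (u) : List.ofFn u = w (i u) ++ List.ofFn (tail u) := by
    calc List.ofFn u = prefixWord (a u) ((w (i u)).length + (N - (w (i u)).length)) := by
          rw [Nat.add_sub_of_le (hN _ (hiI u)), ha]
      _ = _ := by rw [prefixWord_add, hi]; rfl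
  set e : (Fin N → ι) → (i : κ) × (Fin (N - (w i).length) → ι) := fun u => ⟨i u, tail u⟩
  set g : ((i : κ) × (Fin (N - (w i).length) → ι)) → ℝ := fun p => r (w p.1 ++ List.ofFn p.2) ^ s
  have he : Function.Injective e := fun u v huv => List.ofFn_injective <| by
    rw [hsplit u, hsplit v]
    exact congrArg (fun p : (i : κ) × (Fin (N - (w i).length) → ι) => w p.1 ++ List.ofFn p.2) huv
  calc partitionSum r s N = ∑ u, g (e u) :=
        Finset.sum_congr rfl fun u _ => by rw [hsplit u]
    _ = ∑ p ∈ Finset.univ.image e, g p := (Finset.sum_image he.injOn).symm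
    _ ≤ ∑ p ∈ I.sigma fun _ => Finset.univ, g p := by
        refine Finset.sum_le_sum_of_subset_of_nonneg ?_ fun _ _ _ => Real.rpow_nonneg (hr _) _
        exact Finset.image_subset_iff.2 fun u _ =>
          Finset.mem_sigma.2 ⟨hiI u, Finset.mem_univ _⟩
    _ ≤ ∑ i ∈ I, ∑ v : Fin (N - (w i).length) → ι, D ^ s * (r (w i) ^ s * r (List.ofFn v) ^ s) := by
        rw [Finset.sum_sigma]
        refine Finset.sum_le_sum fun i _ => Finset.sum_le_sum fun v _ => ?_
        rw [← mul_assoc, ← Real.mul_rpow hD (hr _),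
          ← Real.mul_rpow (mul_nonneg hD (hr _)) (hr _)]
        exact Real.rpow_le_rpow (hr _) (hmul _ _) hs
    _ = _ := by simp only [partitionSum, Finset.mul_sum]

theorem one_le_sum_of_cover [Fintype ι] [Nonempty ι] {D K : ℝ} (hr : ∀ w, 0 < r w) (hD : 0 ≤ D)
    (hmul : ∀ u v, r (u ++ v) ≤ D * r u * r v) (hs : 0 ≤ s)
    (hsum : ∀ k N, k ≤ N → partitionSum r s k ≤ K * partitionSum r s N) {κ : Type*}
    {I : Finset κ} {w : κ → List ι}
    (hcov : ∀ a : ℕ → ι, ∃ i ∈ I, prefixWord a (w i).length = w i) :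
    1 ≤ D ^ s * K * ∑ i ∈ I, r (w i) ^ s := by
  set N := I.sup fun i => (w i).length
  have hpos : 0 < partitionSum r s N :=
    Finset.sum_pos (fun _ _ => Real.rpow_pos_of_pos (hr _) s) Finset.univ_nonempty
  have h := partitionSum_le_sum_of_cover (fun w => (hr w).le) hD hmul hs hcov
    fun i hi => Finset.le_sup (f := fun i => (w i).length) hi
  refine le_of_mul_le_mul_right ?_ hpos
  calc 1 * partitionSum r s N
      ≤ D ^ s * ∑ i ∈ I, r (w i) ^ s * partitionSum r s (N - (w i).length) := by rwa [one_mul]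
    _ ≤ D ^ s * ∑ i ∈ I, r (w i) ^ s * (K * partitionSum r s N) := by
        gcongr with i
        · exact Real.rpow_nonneg (hr _).le s
        · exact hsum _ _ (Nat.sub_le _ _)
    _ = _ := by rw [← Finset.sum_mul]; ring

variable {X : Type*} [MetricSpace X] {π : (ℕ → ι) → X} {C ρ : ℝ}

theorem hausdorffMeasure_range_le_of_partitionSum_le [MeasurableSpace X] [BorelSpace X]
    [Fintype ι] {B : ℝ} (hr : ∀ w, 0 ≤ r w) (hC : 0 ≤ C) (hρ₀ : 0 ≤ ρ) (hρ : ρ < 1)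
    (hrρ : ∀ w, r w ≤ ρ ^ w.length)
    (hdist : ∀ a b n, prefixWord a n = prefixWord b n →
      dist (π a) (π b) ≤ C * r (prefixWord a n))
    (hs : 0 ≤ s) (hsum : ∀ n, partitionSum r s n ≤ B) :
    μH[s] (Set.range π) ≤ ENNReal.ofReal (C ^ s * B) := by
  set U : ∀ n, (Fin n → ι) → Set X := fun n w => π '' {a | prefixWord a n = List.ofFn w}
  have hdiam (n w) : Metric.ediam (U n w) ≤ ENNReal.ofReal (C * r (List.ofFn w)) := by
    refine Metric.ediam_le ?_
    rintro _ ⟨a, ha, rfl⟩ _ ⟨b, hb, rfl⟩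
    rw [edist_dist, ← show prefixWord a n = _ from ha]
    exact ENNReal.ofReal_le_ofReal (hdist a b n (ha.trans hb.symm))
  have hsmall : Tendsto (fun n => ENNReal.ofReal (C * ρ ^ n)) atTop (𝓝 0) := by
    simpa using ENNReal.tendsto_ofReal
      ((tendsto_pow_atTop_nhds_zero_of_lt_one hρ₀ hρ).const_mul C)
  have hUsum (n) : ∑ w, Metric.ediam (U n w) ^ s ≤ ENNReal.ofReal (C ^ s * B) := by
    calc ∑ w, Metric.ediam (U n w) ^ s
        ≤ ∑ w : Fin n → ι, ENNReal.ofReal (C ^ s * r (List.ofFn w) ^ s) := by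
          refine Finset.sum_le_sum fun w _ => ?_
          rw [← Real.mul_rpow hC (hr _),
            ← ENNReal.ofReal_rpow_of_nonneg (mul_nonneg hC (hr _)) hs]
          exact ENNReal.rpow_le_rpow (hdiam n w) hs
      _ = ENNReal.ofReal (C ^ s * partitionSum r s n) := by
          rw [partitionSum, Finset.mul_sum, ENNReal.ofReal_sum_of_nonneg]
          exact fun w _ => mul_nonneg (Real.rpow_nonneg hC s) (Real.rpow_nonneg (hr _) s)
      _ ≤ _ := ENNReal.ofReal_le_ofReal
          (mul_le_mul_of_nonneg_left (hsum n) (Real.rpow_nonneg hC s))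
  refine (MeasureTheory.Measure.hausdorffMeasure_le_liminf_sum s _ _ hsmall U ?_ ?_).trans <|
    (liminf_le_liminf (.of_forall hUsum)).trans (liminf_const _).le
  · refine .of_forall fun n w => (hdiam n w).trans (ENNReal.ofReal_le_ofReal ?_)
    simpa using mul_le_mul_of_nonneg_left (hrρ (List.ofFn w)) hC
  · refine .of_forall fun n => ?_
    rintro _ ⟨a, rfl⟩
    exact Set.mem_iUnion.2 ⟨fun k => a k, a, rfl, rfl⟩

theorem dimH_range_le_of_partitionSum_le [Fintype ι] {B : ℝ} (hr : ∀ w, 0 ≤ r w) (hC : 0 ≤ C)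
    (hρ₀ : 0 ≤ ρ) (hρ : ρ < 1) (hrρ : ∀ w, r w ≤ ρ ^ w.length)
    (hdist : ∀ a b n, prefixWord a n = prefixWord b n →
      dist (π a) (π b) ≤ C * r (prefixWord a n))
    (hs : 0 ≤ s) (hsum : ∀ n, partitionSum r s n ≤ B) :
    dimH (Set.range π) ≤ ENNReal.ofReal s := by
  borelize X
  have hfin := ne_top_of_le_ne_top ENNReal.ofReal_ne_top <|
    hausdorffMeasure_range_le_of_partitionSum_le hr hC hρ₀ hρ hrρ hdist hs hsum
  rw [← Real.coe_toNNReal s hs] at hfin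
  exact dimH_le_of_hausdorffMeasure_ne_top hfin

theorem exists_cylinder_of_separated [Nonempty ι] (hr : ∀ w, 0 ≤ r w) (hC : 0 ≤ C) (hρ₀ : 0 ≤ ρ)
    (hρ : ρ < 1) (hrρ : ∀ w, r w ≤ ρ ^ w.length)
    (hsep : ∀ a b, a ≠ b → r (prefixWord a (PiNat.firstDiff a b)) ≤ C * dist (π a) (π b))
    (hs : 0 < s) (t : Set X) {ε : ENNReal} (hε : 0 < ε) :
    ∃ w : List ι, (∀ a, π a ∈ t → prefixWord a w.length = w) ∧
      ENNReal.ofReal (r w ^ s) ≤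
        ENNReal.ofReal (C ^ s) * (⨆ _ : t.Nonempty, Metric.ediam t ^ s) + ε := by
  classical
  by_cases hex : ∃ n a b, π a ∈ t ∧ π b ∈ t ∧ a ≠ b ∧ PiNat.firstDiff a b = n
  · obtain ⟨a, b, ha, hb, hab, hn⟩ := Nat.find_spec hex
    refine ⟨prefixWord a (PiNat.firstDiff a b), fun c hc => ?_, le_add_right ?_⟩
    · rw [length_prefixWord, prefixWord_eq_prefixWord, ← PiNat.mem_cylinder_iff]
      obtain rfl | hca := eq_or_ne c a
      · exact PiNat.self_mem_cylinder c _
      · rw [PiNat.mem_cylinder_iff_le_firstDiff hca, hn]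
        exact Nat.find_min' hex ⟨c, a, hc, ha, hca, rfl⟩
    · calc ENNReal.ofReal (r (prefixWord a (PiNat.firstDiff a b)) ^ s)
          ≤ ENNReal.ofReal ((C * dist (π a) (π b)) ^ s) :=
            ENNReal.ofReal_le_ofReal (Real.rpow_le_rpow (hr _) (hsep a b hab) hs.le)
        _ = ENNReal.ofReal (C ^ s) * edist (π a) (π b) ^ s := by
            rw [Real.mul_rpow hC dist_nonneg, ENNReal.ofReal_mul (Real.rpow_nonneg hC s),
              edist_dist, ENNReal.ofReal_rpow_of_nonneg dist_nonneg hs.le]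
        _ ≤ _ := by
            gcongr
            exact le_iSup_of_le ⟨_, ha⟩ <|
              ENNReal.rpow_le_rpow (Metric.edist_le_ediam_of_mem ha hb) hs.le
  · push Not at hex
    obtain ⟨a, ha⟩ : ∃ a, ∀ b, π b ∈ t → b = a := by
      by_cases h : ∃ a, π a ∈ t
      · obtain ⟨a, ha⟩ := h
        exact ⟨a, fun b hb => of_not_not fun hne => hex _ b a hb ha hne rfl⟩
      · exact ⟨Classical.arbitrary _, fun b hb => (h ⟨b, hb⟩).elim⟩
    have hlim : Tendsto (fun n => ENNReal.ofReal ((ρ ^ n) ^ s)) atTop (𝓝 0) := by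
      have h := (tendsto_pow_atTop_nhds_zero_of_lt_one hρ₀ hρ).rpow_const (p := s) (.inr hs.le)
      rw [Real.zero_rpow hs.ne'] at h
      simpa using ENNReal.tendsto_ofReal h
    obtain ⟨n, hn⟩ := (hlim.eventually (gt_mem_nhds hε)).exists
    refine ⟨prefixWord a n, fun b hb => by rw [ha b hb, length_prefixWord], le_add_left ?_⟩
    refine (ENNReal.ofReal_le_ofReal (Real.rpow_le_rpow (hr _) ?_ hs.le)).trans hn.le
    simpa using hrρ (prefixWord a n)

theorem exists_cover_tsum_lt_of_hausdorffMeasure_eq_zero [MeasurableSpace X] [BorelSpace X]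
    {S : Set X} (hS : μH[s] S = 0) {ε : ENNReal} (hε : 0 < ε) :
    ∃ t : ℕ → Set X, S ⊆ ⋃ n, t n ∧ ∑' n, ⨆ _ : (t n).Nonempty, Metric.ediam (t n) ^ s < ε := by
  rw [MeasureTheory.Measure.hausdorffMeasure_apply] at hS
  rw [← bot_eq_zero, ← (iSup₂_eq_bot.1 hS) 1 one_pos] at hε
  simp only [iInf_lt_iff] at hε
  obtain ⟨t, hcov, -, ht⟩ := hε
  exact ⟨t, hcov, ht⟩

theorem exists_finset_cylinder_cover_sum_lt [Finite ι] [Nonempty ι] [MeasurableSpace X]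
    [BorelSpace X] (hr : ∀ w, 0 ≤ r w) (hC : 0 < C) (hρ₀ : 0 ≤ ρ) (hρ : ρ < 1)
    (hrρ : ∀ w, r w ≤ ρ ^ w.length)
    (hsep : ∀ a b, a ≠ b → r (prefixWord a (PiNat.firstDiff a b)) ≤ C * dist (π a) (π b))
    (hs : 0 < s) (hzero : μH[s] (Set.range π) = 0) {c : ℝ} (hc : 0 < c) :
    ∃ (I : Finset ℕ) (w : ℕ → List ι),
      (∀ a : ℕ → ι, ∃ i ∈ I, prefixWord a (w i).length = w i) ∧ ∑ i ∈ I, r (w i) ^ s < c := by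
  let _ : TopologicalSpace ι := ⊥
  have : DiscreteTopology ι := ⟨rfl⟩
  set A : ENNReal := ENNReal.ofReal (C ^ s)
  have hA : A ≠ 0 := (ENNReal.ofReal_pos.2 (by positivity)).ne'
  have hc2 : ENNReal.ofReal c / 2 ≠ 0 := (ENNReal.half_pos (ENNReal.ofReal_pos.2 hc).ne').ne'
  obtain ⟨t, ht, htsum⟩ := exists_cover_tsum_lt_of_hausdorffMeasure_eq_zero hzero
    (ENNReal.div_pos hc2 (ENNReal.ofReal_ne_top (r := C ^ s)))
  obtain ⟨ε, hε, hεsum⟩ := ENNReal.exists_pos_sum_of_countable' hc2 ℕ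
  choose w hw hwle using fun n => exists_cylinder_of_separated hr hC.le hρ₀ hρ hrρ hsep hs (t n)
    (hε n)
  obtain ⟨I, hI⟩ := isCompact_univ.elim_finite_subcover _
    (fun n => isOpen_setOf_prefixWord_eq (w n)) fun a _ =>
      let ⟨n, hn⟩ := Set.mem_iUnion.1 (ht ⟨a, rfl⟩)
      Set.mem_iUnion.2 ⟨n, hw n a hn⟩
  refine ⟨I, w, fun a => by simpa using hI (Set.mem_univ a), ?_⟩
  refine (ENNReal.ofReal_lt_ofReal_iff hc).1 ?_
  rw [ENNReal.ofReal_sum_of_nonneg fun i _ => Real.rpow_nonneg (hr _) s]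
  calc ∑ i ∈ I, ENNReal.ofReal (r (w i) ^ s)
      ≤ ∑' n, (A * (⨆ _ : (t n).Nonempty, Metric.ediam (t n) ^ s) + ε n) :=
        (ENNReal.sum_le_tsum I).trans (ENNReal.tsum_le_tsum hwle)
    _ = A * (∑' n, ⨆ _ : (t n).Nonempty, Metric.ediam (t n) ^ s) + ∑' n, ε n := by
        rw [ENNReal.tsum_add, ENNReal.tsum_mul_left]
    _ < ENNReal.ofReal c / 2 + ENNReal.ofReal c / 2 := by
        refine ENNReal.add_lt_add ?_ hεsum
        rw [mul_comm]
        exact (ENNReal.lt_div_iff_mul_lt (.inl hA) (.inl ENNReal.ofReal_ne_top)).1 htsum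
    _ = ENNReal.ofReal c := ENNReal.add_halves _

theorem le_dimH_range_of_partitionSum_le [Fintype ι] [Nonempty ι] {D K : ℝ} (hr : ∀ w, 0 < r w)
    (hC : 0 < C) (hρ₀ : 0 ≤ ρ) (hρ : ρ < 1) (hrρ : ∀ w, r w ≤ ρ ^ w.length)
    (hsep : ∀ a b, a ≠ b → r (prefixWord a (PiNat.firstDiff a b)) ≤ C * dist (π a) (π b))
    (hD : 0 < D) (hmul : ∀ u v, r (u ++ v) ≤ D * r u * r v) (hs : 0 < s) (hK : 0 < K)
    (hsum : ∀ k N, k ≤ N → partitionSum r s k ≤ K * partitionSum r s N) :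
    ENNReal.ofReal s ≤ dimH (Set.range π) := by
  borelize X
  suffices hne : μH[s] (Set.range π) ≠ 0 by
    rw [← Real.coe_toNNReal s hs.le] at hne
    exact le_dimH_of_hausdorffMeasure_ne_zero hne
  intro hzero
  obtain ⟨I, w, hcov, hlt⟩ := exists_finset_cylinder_cover_sum_lt (fun w => (hr w).le) hC hρ₀ hρ
    hrρ hsep hs hzero (by positivity : 0 < 1 / (D ^ s * K))
  rw [lt_div_iff₀ (by positivity), mul_comm] at hlt
  exact (one_le_sum_of_cover hr hD.le hmul hs.le hsum hcov).not_gt hlt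

end SymbolicCoding

section ContinuedFractions

variable {m : ℕ} {x y : ℝ}

/-- The digit `i + 1 ∈ {1, …, m}` of a continued fraction, encoded by the letter `i : Fin m`. -/
def cfDigit (i : Fin m) : ℝ := (i : ℕ) + 1

/-- The inverse branch `x ↦ [0; a₁, …, aₙ + x]` of the Gauss map coded by a word of letters. -/
noncomputable def cfMap : List (Fin m) → ℝ → ℝ
  | [], x => x
  | i :: w, x => 1 / (cfDigit i + cfMap w x)

/-- The denominator of the Möbius transformation `cfMap w`, whose derivative is therefore
`± 1 / cfDenom w ^ 2`. -/
noncomputable def cfDenom : List (Fin m) → ℝ → ℝ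
  | [], _ => 1
  | i :: w, x => (cfDigit i + cfMap w x) * cfDenom w x

/-- The interval spanned by `1 / (m + 1)` and its image under the branch with digit `1`; every
branch maps it into itself, contracting by at least `((m + 1) / (m + 2)) ^ 2`. -/
def coreInterval (m : ℕ) : Set ℝ := Set.Icc (1 / (m + 1)) ((m + 1) / (m + 2))

theorem one_le_cfDigit (i : Fin m) : 1 ≤ cfDigit i := by simp [cfDigit]

theorem cfDigit_le (i : Fin m) : cfDigit i ≤ m := by
  have : (i : ℕ) + 1 ≤ m := i.isLt
  rw [cfDigit]
  exact_mod_cast this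

theorem one_le_abs_cfDigit_sub {i j : Fin m} (hij : i ≠ j) : 1 ≤ |cfDigit i - cfDigit j| := by
  have : ((i : ℕ) : ℤ) - (j : ℕ) ≠ 0 := sub_ne_zero.2 (by exact_mod_cast Fin.val_ne_of_ne hij)
  have : (1 : ℝ) ≤ |((i : ℕ) : ℝ) - (j : ℕ)| := by exact_mod_cast Int.one_le_abs this
  simpa only [cfDigit, add_sub_add_right_eq_sub] using this

theorem coreInterval_subset_Ioo : coreInterval m ⊆ Set.Ioo 0 1 := fun x hx =>
  ⟨lt_of_lt_of_le (by positivity) hx.1,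
    hx.2.trans_lt ((div_lt_one (by positivity)).2 (by linarith))⟩

theorem half_mem_coreInterval [NeZero m] : (1 / 2 : ℝ) ∈ coreInterval m := by
  have : (1 : ℝ) ≤ m := by exact_mod_cast NeZero.one_le
  refine ⟨one_div_le_one_div_of_le (by positivity) (by linarith), ?_⟩
  rw [div_le_div_iff₀ (by positivity) (by positivity)]
  linarith

theorem branch_mem_coreInterval (i : Fin m) (hx : x ∈ Set.Icc (1 / (m + 1) : ℝ) 1) :
    1 / (cfDigit i + x) ∈ coreInterval m := by
  have hx₀ : 0 < x := lt_of_lt_of_le (by positivity) hx.1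
  have h1 := one_le_cfDigit i
  refine ⟨one_div_le_one_div_of_le (by positivity) (add_le_add (cfDigit_le i) hx.2), ?_⟩
  calc 1 / (cfDigit i + x) ≤ 1 / (1 + 1 / (m + 1)) :=
        one_div_le_one_div_of_le (by positivity) (add_le_add h1 hx.1)
    _ = (m + 1) / (m + 2) := by field_simp; ring

theorem le_cfDigit_add (i : Fin m) (hx : x ∈ coreInterval m) :
    ((m : ℝ) + 2) / (m + 1) ≤ cfDigit i + x := by
  calc ((m : ℝ) + 2) / (m + 1) = 1 + 1 / (m + 1) := by field_simp; ring
    _ ≤ cfDigit i + x := add_le_add (one_le_cfDigit i) hx.1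

theorem branch_mem_coreInterval_of_mem (i : Fin m) (hx : x ∈ coreInterval m) :
    1 / (cfDigit i + x) ∈ coreInterval m :=
  branch_mem_coreInterval i ⟨hx.1, (coreInterval_subset_Ioo hx).2.le⟩

theorem cfMap_mem_coreInterval (w : List (Fin m)) (hx : x ∈ coreInterval m) :
    cfMap w x ∈ coreInterval m := by
  induction w with
  | nil => exact hx
  | cons i w ih => exact branch_mem_coreInterval_of_mem i ih

theorem branch_mem_Icc (i : Fin m) (hx : 0 ≤ x) : 1 / (cfDigit i + x) ∈ Set.Icc (0 : ℝ) 1 := by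
  have := one_le_cfDigit i
  exact ⟨by positivity, (div_le_one (by positivity)).2 (by linarith)⟩

theorem cfMap_nonneg (w : List (Fin m)) (hx : 0 ≤ x) : 0 ≤ cfMap w x := by
  cases w with
  | nil => exact hx
  | cons i w => exact (branch_mem_Icc i (cfMap_nonneg w hx)).1

theorem cfDigit_add_cfMap_pos (i : Fin m) (w : List (Fin m)) (hx : 0 ≤ x) :
    0 < cfDigit i + cfMap w x :=
  add_pos_of_pos_of_nonneg (one_pos.trans_le (one_le_cfDigit i)) (cfMap_nonneg w hx)

theorem cfDenom_pos (w : List (Fin m)) (hx : 0 ≤ x) : 0 < cfDenom w x := by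
  induction w with
  | nil => exact one_pos
  | cons i w ih => exact mul_pos (cfDigit_add_cfMap_pos i w hx) ih

theorem cfMap_append (u v : List (Fin m)) (x : ℝ) : cfMap (u ++ v) x = cfMap u (cfMap v x) := by
  induction u with
  | nil => rfl
  | cons i u ih => simp only [List.cons_append, cfMap, ih]

theorem cfDenom_append (u v : List (Fin m)) (x : ℝ) :
    cfDenom (u ++ v) x = cfDenom u (cfMap v x) * cfDenom v x := by
  induction u with
  | nil => simp [cfDenom]
  | cons i u ih => simp only [List.cons_append, cfDenom, ih, cfMap_append, mul_assoc]

theorem abs_cfMap_sub_cfMap (w : List (Fin m)) (hx : 0 ≤ x) (hy : 0 ≤ y) :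
    |cfMap w x - cfMap w y| = |x - y| / (cfDenom w x * cfDenom w y) := by
  induction w with
  | nil => simp [cfMap, cfDenom]
  | cons i w ih =>
    have hxi := cfDigit_add_cfMap_pos i w hx
    have hyi := cfDigit_add_cfMap_pos i w hy
    have hbranch : cfMap (i :: w) x - cfMap (i :: w) y =
        (cfMap w y - cfMap w x) / ((cfDigit i + cfMap w x) * (cfDigit i + cfMap w y)) := by
      simp only [cfMap]
      rw [div_sub_div _ _ hxi.ne' hyi.ne']
      ring
    rw [hbranch, abs_div, abs_of_pos (mul_pos hxi hyi), abs_sub_comm, ih]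
    simp only [cfDenom]
    rw [div_div]
    congr 1
    ring

theorem exists_cfDenom_eq_affine (w : List (Fin m)) :
    ∃ q r : ℝ, 0 ≤ r ∧ r ≤ q ∧ ∀ x, 0 ≤ x → cfDenom w x = q + r * x := by
  induction w using List.reverseRecOn with
  | nil => exact ⟨1, 0, le_rfl, zero_le_one, fun x _ => by simp [cfDenom]⟩
  | append_singleton w i ih =>
    obtain ⟨q, r, hr, hrq, h⟩ := ih
    have hq : 0 ≤ q := hr.trans hrq
    have hi := one_le_cfDigit i
    refine ⟨q * cfDigit i + r, q, hq, ?_, fun x hx => ?_⟩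
    · linarith [le_mul_of_one_le_right hq hi]
    have : 0 < cfDigit i + x := by positivity
    rw [cfDenom_append]
    simp only [cfDenom, cfMap]
    rw [h _ (by positivity)]
    field_simp
    ring

theorem cfDenom_le_two_mul (w : List (Fin m)) (hx : 0 ≤ x) (hy : y ∈ Set.Icc (0 : ℝ) 1) :
    cfDenom w y ≤ 2 * cfDenom w x := by
  obtain ⟨q, r, hr, hrq, h⟩ := exists_cfDenom_eq_affine w
  rw [h x hx, h y hy.1]
  nlinarith [mul_nonneg hr hx, hy.2]

theorem pow_le_cfDenom (w : List (Fin m)) (hx : x ∈ coreInterval m) :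
    (((m : ℝ) + 2) / (m + 1)) ^ w.length ≤ cfDenom w x := by
  induction w with
  | nil => simp [cfDenom]
  | cons i w ih =>
    rw [List.length_cons, pow_succ', cfDenom]
    exact mul_le_mul (le_cfDigit_add i (cfMap_mem_coreInterval w hx)) ih (by positivity)
      (cfDigit_add_cfMap_pos i w (coreInterval_subset_Ioo hx).1.le).le

/-- The size of the cylinder of continued fractions beginning with a given word, up to the factor
allowed by bounded distortion: the derivative of `cfMap w` at `1 / 2`, in absolute value. -/
noncomputable def cfScale (w : List (Fin m)) : ℝ := (cfDenom w (1 / 2) ^ 2)⁻¹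

theorem cfScale_pos (w : List (Fin m)) : 0 < cfScale w :=
  inv_pos.2 (pow_pos (cfDenom_pos w one_half_pos.le) 2)

theorem cfScale_rpow (w : List (Fin m)) (s : ℝ) :
    cfScale w ^ s = cfDenom w (1 / 2) ^ (-(2 * s)) := by
  have hD := (cfDenom_pos w one_half_pos.le).le
  rw [cfScale, Real.inv_rpow (by positivity), ← Real.rpow_natCast, ← Real.rpow_mul hD,
    Real.rpow_neg hD, Nat.cast_ofNat]

theorem cfScale_le_pow [NeZero m] (w : List (Fin m)) :
    cfScale w ≤ ((((m : ℝ) + 1) / (m + 2)) ^ 2) ^ w.length := by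
  have h := pow_le_cfDenom w half_mem_coreInterval
  calc cfScale w ≤ (((((m : ℝ) + 2) / (m + 1)) ^ w.length) ^ 2)⁻¹ := by
        rw [cfScale]; gcongr
    _ = ((((m : ℝ) + 1) / (m + 2)) ^ 2) ^ w.length := by
        rw [← pow_mul, mul_comm, pow_mul, ← inv_pow, ← inv_pow, inv_div]

theorem cfScale_append_le (u v : List (Fin m)) :
    cfScale (u ++ v) ≤ 4 * cfScale u * cfScale v := by
  have hv : 0 ≤ cfMap v (1 / 2) := cfMap_nonneg v one_half_pos.le
  have hu₀ := cfDenom_pos u one_half_pos.le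
  have hv₀ := cfDenom_pos v one_half_pos.le
  have hu : cfDenom u (1 / 2) / 2 ≤ cfDenom u (cfMap v (1 / 2)) := by
    linarith [cfDenom_le_two_mul u hv (y := 1 / 2) ⟨by norm_num, by norm_num⟩]
  calc cfScale (u ++ v) ≤ ((cfDenom u (1 / 2) / 2 * cfDenom v (1 / 2)) ^ 2)⁻¹ := by
        rw [cfScale, cfDenom_append]; gcongr
    _ = 4 * cfScale u * cfScale v := by simp only [cfScale]; field_simp; norm_num

theorem abs_cfMap_sub_cfMap_le (w : List (Fin m)) (hx : x ∈ Set.Icc (0 : ℝ) 1)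
    (hy : y ∈ Set.Icc (0 : ℝ) 1) : |cfMap w x - cfMap w y| ≤ 4 * cfScale w := by
  have hz : (1 / 2 : ℝ) ∈ Set.Icc (0 : ℝ) 1 := ⟨by norm_num, by norm_num⟩
  have hw := cfDenom_pos w hz.1
  have hwx₀ := cfDenom_pos w hx.1
  have hwx : cfDenom w (1 / 2) / 2 ≤ cfDenom w x := by linarith [cfDenom_le_two_mul w hx.1 hz]
  have hwy : cfDenom w (1 / 2) / 2 ≤ cfDenom w y := by linarith [cfDenom_le_two_mul w hy.1 hz]
  have hxy : |x - y| ≤ 1 := abs_le.2 ⟨by linarith [hx.1, hy.2], by linarith [hx.2, hy.1]⟩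
  rw [abs_cfMap_sub_cfMap w hx.1 hy.1]
  calc |x - y| / (cfDenom w x * cfDenom w y)
      ≤ 1 / (cfDenom w (1 / 2) / 2 * (cfDenom w (1 / 2) / 2)) := by gcongr
    _ = 4 * cfScale w := by rw [cfScale]; field_simp; norm_num

theorem mul_cfScale_le_abs_cfMap_sub_cfMap (w : List (Fin m)) (hx : x ∈ Set.Icc (0 : ℝ) 1)
    (hy : y ∈ Set.Icc (0 : ℝ) 1) : |x - y| * cfScale w ≤ 4 * |cfMap w x - cfMap w y| := by
  have hxw := cfDenom_pos w hx.1
  have hyw := cfDenom_pos w hy.1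
  have hw := cfDenom_pos w one_half_pos.le
  rw [abs_cfMap_sub_cfMap w hx.1 hy.1]
  calc |x - y| * cfScale w = 4 * (|x - y| / (2 * cfDenom w (1 / 2) * (2 * cfDenom w (1 / 2)))) := by
        rw [cfScale]; field_simp; norm_num
    _ ≤ 4 * (|x - y| / (cfDenom w x * cfDenom w y)) := by
        gcongr
        · exact cfDenom_le_two_mul w one_half_pos.le hx
        · exact cfDenom_le_two_mul w one_half_pos.le hy

theorem one_div_pow_le_abs_branch_sub_branch {i j : Fin m} (hij : i ≠ j) (hx : x ∈ coreInterval m)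
    (hy : y ∈ coreInterval m) :
    1 / ((m : ℝ) + 1) ^ 3 ≤ |1 / (cfDigit i + x) - 1 / (cfDigit j + y)| := by
  have hx₀ := coreInterval_subset_Ioo hx
  have hy₀ := coreInterval_subset_Ioo hy
  have hi := one_le_cfDigit i
  have hj := one_le_cfDigit j
  have hgap : 1 / ((m : ℝ) + 1) ≤ |(cfDigit j + y) - (cfDigit i + x)| := by
    have hlength : ((m : ℝ) + 1) / (m + 2) ≤ 1 := (div_le_one (by positivity)).2 (by linarith)
    have hyx : |y - x| ≤ 1 - 1 / (m + 1) :=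
      abs_le.2 ⟨by linarith [hy.1, hx.2], by linarith [hy.2, hx.1]⟩
    have := abs_sub_abs_le_abs_sub (cfDigit j - cfDigit i) (x - y)
    rw [abs_sub_comm x y] at this
    rw [show cfDigit j + y - (cfDigit i + x) = cfDigit j - cfDigit i - (x - y) by ring]
    linarith [one_le_abs_cfDigit_sub hij.symm]
  have hxi : 0 < cfDigit i + x := by linarith [hx₀.1]
  have hyj : 0 < cfDigit j + y := by linarith [hy₀.1]
  rw [div_sub_div _ _ hxi.ne' hyj.ne', abs_div, abs_of_pos (mul_pos hxi hyj), one_mul, mul_one]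
  calc 1 / ((m : ℝ) + 1) ^ 3 = 1 / (m + 1) / ((m + 1) * (m + 1)) := by field_simp
    _ ≤ _ := by
      gcongr
      exacts [cfDigit_le i, hx₀.2.le, cfDigit_le j, hy₀.2.le]

theorem convs'Aux_digitContFract (a : ℕ → Fin m) (n : ℕ) :
    GenContFract.convs'Aux (digitContFract fun k => a k + 1).s n = cfMap (prefixWord a n) 0 := by
  induction n generalizing a with
  | zero => rfl
  | succ n ih =>
    rw [prefixWord_succ, cfMap, ← ih fun k => a (k + 1)]
    simp only [cfDigit, ← Nat.cast_add_one]
    rfl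

theorem sq_contraction_lt_one (m : ℕ) : (((m : ℝ) + 1) / (m + 2)) ^ 2 < 1 :=
  pow_lt_one₀ (by positivity) ((div_lt_one (by positivity)).2 (by linarith)) two_ne_zero

section CfValue

variable [NeZero m]

theorem cauchySeq_cfMap_prefixWord (a : ℕ → Fin m) :
    CauchySeq fun n => cfMap (prefixWord a n) 0 := by
  refine cauchySeq_of_le_geometric _ 4 (sq_contraction_lt_one m) fun n => ?_
  have hsucc : cfMap (prefixWord a (n + 1)) 0 =
      cfMap (prefixWord a n) (1 / (cfDigit (a n) + 0)) := by
    rw [prefixWord_add, cfMap_append]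
    rfl
  rw [hsucc, Real.dist_eq]
  calc _ ≤ 4 * cfScale (prefixWord a n) :=
        abs_cfMap_sub_cfMap_le _ ⟨le_rfl, zero_le_one⟩ (branch_mem_Icc _ le_rfl)
    _ ≤ 4 * ((((m : ℝ) + 1) / (m + 2)) ^ 2) ^ n := by
        have := cfScale_le_pow (prefixWord a n)
        rw [length_prefixWord] at this
        gcongr

/-- The continued fraction `[0; a 0 + 1, a 1 + 1, …]` coded by a sequence of letters. -/
noncomputable def cfValue (a : ℕ → Fin m) : ℝ :=
  limUnder atTop fun n => cfMap (prefixWord a n) 0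

theorem tendsto_cfMap_prefixWord (a : ℕ → Fin m) :
    Tendsto (fun n => cfMap (prefixWord a n) 0) atTop (𝓝 (cfValue a)) :=
  (cauchySeq_cfMap_prefixWord a).tendsto_limUnder

theorem cfValue_nonneg (a : ℕ → Fin m) : 0 ≤ cfValue a :=
  ge_of_tendsto' (tendsto_cfMap_prefixWord a) fun _ => cfMap_nonneg _ le_rfl

theorem cfValue_eq_branch (a : ℕ → Fin m) :
    cfValue a = 1 / (cfDigit (a 0) + cfValue fun k => a (k + 1)) := by
  have htail := tendsto_cfMap_prefixWord fun k => a (k + 1)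
  have hpos := one_le_cfDigit (a 0)
  have hnonneg := cfValue_nonneg fun k => a (k + 1)
  refine tendsto_nhds_unique ((tendsto_add_atTop_iff_nat 1).2 (tendsto_cfMap_prefixWord a)) ?_
  simp only [prefixWord_succ, cfMap]
  exact tendsto_const_nhds.div (htail.const_add _) (by positivity)

theorem cfValue_mem_coreInterval (a : ℕ → Fin m) : cfValue a ∈ coreInterval m := by
  have hle_one (b : ℕ → Fin m) : cfValue b ≤ 1 := by
    rw [cfValue_eq_branch]
    exact (branch_mem_Icc _ (cfValue_nonneg _)).2
  have hge (b : ℕ → Fin m) : 1 / ((m : ℝ) + 1) ≤ cfValue b := by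
    rw [cfValue_eq_branch]
    have := one_le_cfDigit (b 0)
    have := cfValue_nonneg fun k => b (k + 1)
    exact one_div_le_one_div_of_le (by positivity) (add_le_add (cfDigit_le _) (hle_one _))
  rw [cfValue_eq_branch]
  exact branch_mem_coreInterval _ ⟨hge _, hle_one _⟩

theorem cfValue_mem_Icc (a : ℕ → Fin m) : cfValue a ∈ Set.Icc (0 : ℝ) 1 :=
  Set.Ioo_subset_Icc_self (coreInterval_subset_Ioo (cfValue_mem_coreInterval a))

theorem cfValue_eq_cfMap (a : ℕ → Fin m) (n : ℕ) :
    cfValue a = cfMap (prefixWord a n) (cfValue fun k => a (n + k)) := by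
  induction n generalizing a with
  | zero => simp [prefixWord, cfMap]
  | succ n ih =>
    rw [cfValue_eq_branch, ih]
    simp only [prefixWord_succ, cfMap, Nat.add_right_comm, Nat.add_assoc]

theorem isContFractValue_cfValue (a : ℕ → Fin m) :
    IsContFractValue (fun k => a k + 1) (cfValue a) := by
  refine (tendsto_cfMap_prefixWord a).congr fun n => ?_
  rw [← convs'Aux_digitContFract, GenContFract.convs']
  simp [digitContFract]

theorem contFractSet_eq_range_cfValue : contFractSet m = Set.range (cfValue (m := m)) := by
  refine Set.Subset.antisymm ?_ ?_
  · rintro x ⟨a, ha, hx⟩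
    have ha' (n : ℕ) : 1 ≤ a n ∧ a n ≤ m := Finset.mem_Icc.1 (ha n)
    have hdigits : a = fun n => a n - 1 + 1 := funext fun n => (Nat.sub_add_cancel (ha' n).1).symm
    rw [hdigits] at hx
    exact ⟨fun n => ⟨a n - 1, by have := ha' n; omega⟩,
      tendsto_nhds_unique (isContFractValue_cfValue _) hx⟩
  · rintro _ ⟨a, rfl⟩
    exact ⟨fun n => a n + 1, fun n => Finset.mem_Icc.2 ⟨Nat.le_add_left _ _, (a n).isLt⟩,
      isContFractValue_cfValue a⟩

theorem dist_cfValue_le {a b : ℕ → Fin m} {n : ℕ} (hab : prefixWord a n = prefixWord b n) :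
    dist (cfValue a) (cfValue b) ≤ 4 * cfScale (prefixWord a n) := by
  rw [Real.dist_eq, cfValue_eq_cfMap a n, cfValue_eq_cfMap b n, ← hab]
  exact abs_cfMap_sub_cfMap_le _ (cfValue_mem_Icc _) (cfValue_mem_Icc _)

theorem cfScale_firstDiff_le_dist {a b : ℕ → Fin m} (hab : a ≠ b) :
    cfScale (prefixWord a (PiNat.firstDiff a b)) ≤
      4 * ((m : ℝ) + 1) ^ 3 * dist (cfValue a) (cfValue b) := by
  set n := PiNat.firstDiff a b
  set a' : ℕ → Fin m := fun k => a (n + k)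
  set b' : ℕ → Fin m := fun k => b (n + k)
  have hw : prefixWord a n = prefixWord b n :=
    prefixWord_eq_prefixWord.2 fun k hk => PiNat.apply_eq_of_lt_firstDiff hk
  have hxy : 1 / ((m : ℝ) + 1) ^ 3 ≤ |cfValue a' - cfValue b'| := by
    rw [cfValue_eq_branch a', cfValue_eq_branch b']
    exact one_div_pow_le_abs_branch_sub_branch (PiNat.apply_firstDiff_ne hab)
      (cfValue_mem_coreInterval _) (cfValue_mem_coreInterval _)
  have hscale := cfScale_pos (prefixWord a n)
  rw [Real.dist_eq, cfValue_eq_cfMap a n, cfValue_eq_cfMap b n, ← hw]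
  calc cfScale (prefixWord a n)
      = ((m : ℝ) + 1) ^ 3 * (1 / ((m : ℝ) + 1) ^ 3 * cfScale (prefixWord a n)) := by field_simp
    _ ≤ ((m : ℝ) + 1) ^ 3 * (|cfValue a' - cfValue b'| * cfScale (prefixWord a n)) := by gcongr
    _ ≤ ((m : ℝ) + 1) ^ 3 * (4 * |cfMap (prefixWord a n) (cfValue a') -
          cfMap (prefixWord a n) (cfValue b')|) := by
        have := mul_cfScale_le_abs_cfMap_sub_cfMap (prefixWord a n) (cfValue_mem_Icc a')
          (cfValue_mem_Icc b')
        exact mul_le_mul_of_nonneg_left this (by positivity)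
    _ = _ := by ring

end CfValue

section TransferOperator

variable {s c M : ℝ} {f g : ℝ → ℝ}

/-- The transfer operator `f ↦ ∑ᵢ |φᵢ'| ^ s • f ∘ φᵢ` of the inverse branches
`φᵢ x = 1 / (cfDigit i + x)`. -/
noncomputable def transferOp (m : ℕ) (s : ℝ) (f : ℝ → ℝ) (x : ℝ) : ℝ :=
  ∑ i : Fin m, (cfDigit i + x) ^ (-(2 * s)) * f (1 / (cfDigit i + x))

theorem iterate_transferOp (f : ℝ → ℝ) (hx : 0 ≤ x) (n : ℕ) :
    (transferOp m s)^[n] f x = ∑ w : Fin n → Fin m,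
      cfDenom (List.ofFn w) x ^ (-(2 * s)) * f (cfMap (List.ofFn w) x) := by
  induction n generalizing f with
  | zero => simp [cfDenom, cfMap]
  | succ n ih =>
    rw [Function.iterate_succ_apply, ih, ← (Fin.consEquiv fun _ => Fin m).sum_comp,
      Fintype.sum_prod_type_right]
    refine Finset.sum_congr rfl fun w _ => ?_
    rw [transferOp, Finset.mul_sum]
    refine Finset.sum_congr rfl fun i _ => ?_
    have hi := cfDigit_add_cfMap_pos i (List.ofFn w) hx
    have hw := cfDenom_pos (List.ofFn w) hx
    simp only [Fin.consEquiv, Equiv.coe_fn_mk, List.ofFn_cons, cfDenom, cfMap]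
    rw [Real.mul_rpow hi.le hw.le]
    ring

theorem transferOp_le_transferOp (h : ∀ x ∈ coreInterval m, f x ≤ g x)
    (hx : x ∈ coreInterval m) : transferOp m s f x ≤ transferOp m s g x := by
  refine Finset.sum_le_sum fun i _ => mul_le_mul_of_nonneg_left
    (h _ (branch_mem_coreInterval_of_mem i hx)) (Real.rpow_nonneg ?_ _)
  exact add_nonneg (zero_le_one.trans (one_le_cfDigit i)) (coreInterval_subset_Ioo hx).1.le

theorem iterate_transferOp_le (h : ∀ x ∈ coreInterval m, transferOp m s f x ≤ f x) (n : ℕ)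
    (hx : x ∈ coreInterval m) : (transferOp m s)^[n] f x ≤ f x := by
  induction n generalizing x with
  | zero => rfl
  | succ n ih =>
    rw [Function.iterate_succ_apply']
    exact (transferOp_le_transferOp (fun y hy => ih hy) hx).trans (h x hx)

theorem monotone_iterate_transferOp (h : ∀ x ∈ coreInterval m, f x ≤ transferOp m s f x)
    (hx : x ∈ coreInterval m) : Monotone fun n => (transferOp m s)^[n] f x := by
  refine monotone_nat_of_le_succ fun n => ?_
  induction n generalizing x with
  | zero => exact h x hx
  | succ n ih =>
    rw [Function.iterate_succ_apply', Function.iterate_succ_apply' _ (n + 1)]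
    exact transferOp_le_transferOp (fun y hy => ih hy) hx

theorem one_add_mul_le_rpow {b t : ℝ} (hb : 0 < b) (ht : 0 ≤ t) : 1 + t * (1 - b⁻¹) ≤ b ^ t := by
  calc 1 + t * (1 - b⁻¹) ≤ t * Real.log b + 1 := by
        rw [add_comm]
        gcongr
        exact Real.one_sub_inv_le_log_of_pos hb
    _ ≤ Real.exp (t * Real.log b) := Real.add_one_le_exp _
    _ = b ^ t := by rw [Real.rpow_def_of_pos hb, mul_comm]

theorem one_add_le_cfDigit_add_rpow (i : Fin m) (hx : x ∈ coreInterval m) {δ : ℝ} (hδ : 0 ≤ δ) :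
    1 + 2 * δ / (m + 2) ≤ (cfDigit i + x) ^ (2 * δ) := by
  calc 1 + 2 * δ / (m + 2) = 1 + 2 * δ * (1 - (((m : ℝ) + 2) / (m + 1))⁻¹) := by
        field_simp
        ring
    _ ≤ (((m : ℝ) + 2) / (m + 1)) ^ (2 * δ) := one_add_mul_le_rpow (by positivity) (by positivity)
    _ ≤ (cfDigit i + x) ^ (2 * δ) := by
        gcongr
        exact le_cfDigit_add i hx

theorem transferOp_add_le {δ : ℝ} (hδ : 0 ≤ δ) (hf : ∀ x ∈ coreInterval m, 0 ≤ f x)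
    (hx : x ∈ coreInterval m) :
    (1 + 2 * δ / (m + 2)) * transferOp m (s + δ) f x ≤ transferOp m s f x := by
  rw [transferOp, transferOp, Finset.mul_sum]
  refine Finset.sum_le_sum fun i _ => ?_
  have hpos : 0 < cfDigit i + x := lt_of_lt_of_le (by positivity) (le_cfDigit_add i hx)
  have hexp : -(2 * s) = 2 * δ + -(2 * (s + δ)) := by ring
  have := hf _ (branch_mem_coreInterval_of_mem i hx)
  rw [hexp, Real.rpow_add hpos, mul_assoc]
  gcongr
  exact one_add_le_cfDigit_add_rpow i hx hδ

variable [NeZero m]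

theorem mul_partitionSum_le_iterate_transferOp (hf : ∀ x ∈ coreInterval m, c ≤ f x) (n : ℕ) :
    c * partitionSum (cfScale (m := m)) s n ≤ (transferOp m s)^[n] f (1 / 2) := by
  rw [iterate_transferOp f one_half_pos.le, partitionSum, Finset.mul_sum]
  refine Finset.sum_le_sum fun w _ => ?_
  rw [cfScale_rpow, mul_comm c]
  exact mul_le_mul_of_nonneg_left (hf _ (cfMap_mem_coreInterval _ half_mem_coreInterval))
    (Real.rpow_nonneg (cfDenom_pos _ one_half_pos.le).le _)

theorem iterate_transferOp_le_mul_partitionSum (hf : ∀ x ∈ coreInterval m, f x ≤ M) (n : ℕ) :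
    (transferOp m s)^[n] f (1 / 2) ≤ M * partitionSum (cfScale (m := m)) s n := by
  rw [iterate_transferOp f one_half_pos.le, partitionSum, Finset.mul_sum]
  refine Finset.sum_le_sum fun w _ => ?_
  rw [cfScale_rpow, mul_comm M]
  exact mul_le_mul_of_nonneg_left (hf _ (cfMap_mem_coreInterval _ half_mem_coreInterval))
    (Real.rpow_nonneg (cfDenom_pos _ one_half_pos.le).le _)

theorem dimH_contFractSet_le (hs : 0 ≤ s) (hc : 0 < c) (hf : ∀ x ∈ coreInterval m, c ≤ f x)
    (h : ∀ x ∈ coreInterval m, transferOp m s f x ≤ f x) :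
    dimH (contFractSet m) ≤ ENNReal.ofReal s := by
  rw [contFractSet_eq_range_cfValue]
  refine dimH_range_le_of_partitionSum_le (B := f (1 / 2) / c) (fun w => (cfScale_pos w).le)
    zero_le_four (by positivity) (sq_contraction_lt_one m) cfScale_le_pow
    (fun a b n hab => dist_cfValue_le hab) hs fun n => (le_div_iff₀' hc).2 ?_
  exact (mul_partitionSum_le_iterate_transferOp hf n).trans
    (iterate_transferOp_le h n half_mem_coreInterval)

theorem le_dimH_contFractSet (hs : 0 < s) (hc : 0 < c) (hf : ∀ x ∈ coreInterval m, c ≤ f x)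
    (hfM : ∀ x ∈ coreInterval m, f x ≤ M) (h : ∀ x ∈ coreInterval m, f x ≤ transferOp m s f x) :
    ENNReal.ofReal s ≤ dimH (contFractSet m) := by
  have hM : 0 < M :=
    hc.trans_le ((hf _ half_mem_coreInterval).trans (hfM _ half_mem_coreInterval))
  rw [contFractSet_eq_range_cfValue]
  refine le_dimH_range_of_partitionSum_le (K := M / c) cfScale_pos (by positivity)
    (by positivity) (sq_contraction_lt_one m) cfScale_le_pow
    (fun a b hab => cfScale_firstDiff_le_dist hab) zero_lt_four cfScale_append_le hs
    (by positivity) fun k N hkN => ?_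
  rw [div_mul_eq_mul_div, le_div_iff₀' hc]
  calc c * partitionSum cfScale s k ≤ (transferOp m s)^[k] f (1 / 2) :=
        mul_partitionSum_le_iterate_transferOp hf k
    _ ≤ (transferOp m s)^[N] f (1 / 2) := monotone_iterate_transferOp h half_mem_coreInterval hkN
    _ ≤ M * partitionSum cfScale s N := iterate_transferOp_le_mul_partitionSum hfM N

theorem dimH_contFractSet_le_add {δ : ℝ} (hs : 0 ≤ s) (hδ : 0 ≤ δ) (hc : 0 < c)
    (hf : ∀ x ∈ coreInterval m, c ≤ f x)
    (h : ∀ x ∈ coreInterval m, transferOp m s f x ≤ (1 + 2 * δ / (m + 2)) * f x) :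
    dimH (contFractSet m) ≤ ENNReal.ofReal (s + δ) := by
  refine dimH_contFractSet_le (add_nonneg hs hδ) hc hf fun x hx => ?_
  have hf₀ : ∀ x ∈ coreInterval m, 0 ≤ f x := fun y hy => hc.le.trans (hf y hy)
  exact le_of_mul_le_mul_left ((transferOp_add_le hδ hf₀ hx).trans (h x hx)) (by positivity)

theorem sub_le_dimH_contFractSet {δ : ℝ} (hδ : 0 ≤ δ) (hδs : δ < s) (hc : 0 < c)
    (hf : ∀ x ∈ coreInterval m, c ≤ f x) (hfM : ∀ x ∈ coreInterval m, f x ≤ M)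
    (h : ∀ x ∈ coreInterval m, f x ≤ (1 + 2 * δ / (m + 2)) * transferOp m s f x) :
    ENNReal.ofReal (s - δ) ≤ dimH (contFractSet m) := by
  refine le_dimH_contFractSet (sub_pos.2 hδs) hc hf hfM fun x hx => (h x hx).trans ?_
  have hf₀ : ∀ x ∈ coreInterval m, 0 ≤ f x := fun y hy => hc.le.trans (hf y hy)
  simpa only [sub_add_cancel] using transferOp_add_le (s := s - δ) hδ hf₀ hx

end TransferOperator

end ContinuedFractions

/-- Polynomials with rational coefficients, given by the list of their coefficients in order of
increasing degree, so that numerical bounds on them can be verified by kernel computation. -/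
abbrev RatPoly := List ℚ

namespace RatPoly

variable {K : Type*}

/-- Evaluation, by Horner's scheme, at a point of a field extending `ℚ`. -/
def eval [Field K] : RatPoly → K → K
  | [], _ => 0
  | a :: p, x => a + x * eval p x

/-- The sum of two polynomials. -/
def add : RatPoly → RatPoly → RatPoly
  | [], q => q
  | a :: p, [] => a :: p
  | a :: p, b :: q => (a + b) :: add p q

/-- The product of a polynomial by a scalar. -/
def smul (c : ℚ) (p : RatPoly) : RatPoly := p.map (c * ·)

/-- The difference of two polynomials. -/
def sub (p q : RatPoly) : RatPoly := p.add (q.smul (-1))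

/-- The product of two polynomials. -/
def mul : RatPoly → RatPoly → RatPoly
  | [], _ => []
  | a :: p, q => (q.smul a).add (0 :: mul p q)

/-- The powers of a polynomial. -/
def pow (p : RatPoly) : ℕ → RatPoly
  | 0 => [1]
  | n + 1 => p.mul (pow p n)

/-- The derivative, by the recursion `(a + X * p)' = p + X * p'`. -/
def deriv : RatPoly → RatPoly
  | [] => []
  | _ :: p => add p (0 :: deriv p)

/-- The homogenization `∑ k ≤ d, aₖ * u ^ k * v ^ (d - k)` of `∑ k ≤ d, aₖ * X ^ k`. -/
def homogenize (u v : RatPoly) : RatPoly → RatPoly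
  | [] => []
  | a :: p => ((v.pow p.length).smul a).add (u.mul (homogenize u v p))

/-- The weighted `ℓ¹` norm `∑ k, |aₖ| * ρ ^ k`, which bounds the polynomial for `|x| ≤ ρ`. -/
def l1Norm (ρ : ℚ) : RatPoly → ℚ
  | [] => 0
  | a :: p => |a| + ρ * l1Norm ρ p

/-- The defect `(c + X) * p' + σ * p` of the differential equation satisfied by
`(c + X) ^ (-σ)`. -/
def eulerDefect (c σ : ℚ) (p : RatPoly) : RatPoly := (mul [c, 1] p.deriv).add (p.smul σ)

theorem eval_linear [Field K] (a b : ℚ) (x : K) : eval [a, b] x = a + b * x := by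
  simp only [eval]
  ring

section Field

variable [Field K] [CharZero K]

theorem ratCast_eval (p : RatPoly) (x : ℚ) : ((p.eval x : ℚ) : K) = p.eval (x : K) := by
  induction p with
  | nil => simp [eval]
  | cons a p ih => simp [eval, ih]

theorem eval_add (p q : RatPoly) (x : K) : (p.add q).eval x = p.eval x + q.eval x := by
  induction p generalizing q with
  | nil => simp [add, eval]
  | cons a p ih =>
    cases q with
    | nil => simp [add, eval]
    | cons b q =>
      simp only [add, eval, ih]
      push_cast
      ring

theorem eval_smul (c : ℚ) (p : RatPoly) (x : K) : (p.smul c).eval x = c * p.eval x := by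
  induction p with
  | nil => simp [smul, eval]
  | cons a p ih =>
    simp only [smul, List.map_cons, eval] at ih ⊢
    rw [ih]
    push_cast
    ring

theorem eval_sub (p q : RatPoly) (x : K) : (p.sub q).eval x = p.eval x - q.eval x := by
  rw [sub, eval_add, eval_smul]
  push_cast
  ring

theorem eval_mul (p q : RatPoly) (x : K) : (p.mul q).eval x = p.eval x * q.eval x := by
  induction p with
  | nil => simp [mul, eval]
  | cons a p ih =>
    simp only [mul, eval_add, eval_smul, eval, ih, Rat.cast_zero]
    ring

theorem eval_pow (p : RatPoly) (n : ℕ) (x : K) : (p.pow n).eval x = p.eval x ^ n := by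
  induction n with
  | zero => simp [pow, eval]
  | succ n ih => rw [pow, eval_mul, ih, pow_succ']

theorem eval_eulerDefect (c σ : ℚ) (p : RatPoly) (x : K) :
    (eulerDefect c σ p).eval x = (c + x) * p.deriv.eval x + σ * p.eval x := by
  rw [eulerDefect, eval_add, eval_mul, eval_smul, eval_linear, Rat.cast_one, one_mul]

theorem eval_homogenize_mul (u v p : RatPoly) {x : K} (hv : v.eval x ≠ 0) :
    (homogenize u v p).eval x * v.eval x =
      v.eval x ^ p.length * p.eval (u.eval x / v.eval x) := by
  induction p with
  | nil => simp [homogenize, eval]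
  | cons a p ih =>
    simp only [homogenize, eval_add, eval_smul, eval_mul, eval_pow, List.length_cons, eval]
    rw [add_mul, mul_assoc (eval u x), ih, pow_succ]
    field_simp

end Field

theorem abs_eval_le_l1Norm [Field K] [LinearOrder K] [IsStrictOrderedRing K] {ρ : ℚ} (p : RatPoly)
    {x : K} (hx : |x| ≤ ρ) : |p.eval x| ≤ (p.l1Norm ρ : ℚ) := by
  induction p with
  | nil => simp [eval, l1Norm]
  | cons a p ih =>
    simp only [eval, l1Norm]
    push_cast
    calc |(a : K) + x * eval p x| ≤ |(a : K)| + |x| * |eval p x| := by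
          rw [← abs_mul]; exact abs_add_le _ _
      _ ≤ |(a : K)| + ρ * (l1Norm ρ p : ℚ) := by gcongr; exact (abs_nonneg x).trans hx

theorem abs_eval_le_of_l1Norm_le [Field K] [LinearOrder K] [IsStrictOrderedRing K] {ρ ε : ℚ}
    {p : RatPoly} (hp : p.l1Norm ρ ≤ ε) {x : K} (hx : |x| ≤ ρ) : |p.eval x| ≤ ε :=
  (abs_eval_le_l1Norm p hx).trans (Rat.cast_le.2 hp)

theorem hasDerivAt_eval (p : RatPoly) (x : ℝ) : HasDerivAt p.eval (p.deriv.eval x) x := by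
  induction p with
  | nil => exact hasDerivAt_const x _
  | cons a p ih =>
    refine (((hasDerivAt_id x).mul ih).const_add (a : ℝ)).congr_deriv ?_
    simp [deriv, eval_add, eval]

theorem hasDerivAt_eval_mul_rpow {c : ℚ} (σ : ℚ) (p : RatPoly) {x : ℝ} (hx : 0 < c + x) :
    HasDerivAt (fun t : ℝ => p.eval t * (c + t) ^ (σ : ℝ))
      ((c + x) ^ ((σ : ℝ) - 1) * (eulerDefect c σ p).eval x) x := by
  have hlinear : HasDerivAt (fun t : ℝ => (c : ℝ) + t) 1 x := (hasDerivAt_id x).const_add _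
  refine ((hasDerivAt_eval p x).mul
    (hlinear.rpow_const (p := (σ : ℝ)) (Or.inl hx.ne'))).congr_deriv ?_
  have hsplit : (c + x : ℝ) ^ (σ : ℝ) = (c + x) ^ ((σ : ℝ) - 1) * (c + x) := by
    rw [← Real.rpow_add_one hx.ne', sub_add_cancel]
  rw [eval_eulerDefect, hsplit]
  ring

theorem abs_eval_mul_rpow_sub_le {c σ ρ ε : ℚ} {p : RatPoly} (hσ : 1 ≤ σ) (hρ : ρ < c)
    (hp : (eulerDefect c σ p).l1Norm ρ ≤ ε) {x y : ℝ} (hx : |x| ≤ ρ) (hy : |y| ≤ ρ) :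
    |p.eval x * (c + x) ^ (σ : ℝ) - p.eval y * (c + y) ^ (σ : ℝ)| ≤
      (c + ρ) ^ ((σ : ℝ) - 1) * ε * |x - y| := by
  have hσ' : (1 : ℝ) ≤ σ := by exact_mod_cast hσ
  have hρ' : (ρ : ℝ) < c := by exact_mod_cast hρ
  have hpos {t : ℝ} (ht : t ∈ Set.Icc (-ρ : ℝ) ρ) : 0 < c + t := by linarith [ht.1]
  refine (convex_Icc (-ρ : ℝ) ρ).norm_image_sub_le_of_norm_hasDerivWithin_le
    (fun t ht => (hasDerivAt_eval_mul_rpow σ p (hpos ht)).hasDerivWithinAt) (fun t ht => ?_)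
    (abs_le.1 hy) (abs_le.1 hx)
  have hct := hpos ht
  have hcρ : (0 : ℝ) < c + ρ := hpos (Set.right_mem_Icc.2 (by linarith [ht.1, ht.2]))
  rw [Real.norm_eq_abs, abs_mul, abs_of_nonneg (Real.rpow_nonneg hct.le _)]
  gcongr
  · exact ht.2
  · exact abs_eval_le_of_l1Norm_le hp (abs_le.2 ht)

/-- The quotient by `c + X` of a power series divided from its constant term upwards, rounded
and with the previous quotient coefficient `b`. -/
def divLinearFrom (round : ℚ → ℚ) (c b : ℚ) : RatPoly → RatPoly
  | [] => []
  | a :: p => round ((a - b) / c) :: divLinearFrom round c (round ((a - b) / c)) p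

/-- The quotient by `(c + X) ^ k` as a power series, truncated to `n` coefficients and rounded. -/
def divLinearPow (round : ℚ → ℚ) (n : ℕ) (c : ℚ) : ℕ → RatPoly → RatPoly
  | 0, p => p
  | k + 1, p => divLinearPow round n c k (divLinearFrom round c 0 (p.take n))

/-- The `n` coefficients from degree `k` on, the first one being `a`, of a power series
proportional to `(c + X) ^ (-σ)`, rounded. -/
def rpowCoeffs (round : ℚ → ℚ) (c σ : ℚ) : ℕ → ℚ → ℕ → RatPoly
  | 0, _, _ => []
  | n + 1, a, k => a :: rpowCoeffs round c σ n (round (-(σ + k) * a / (c * (k + 1)))) (k + 1)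

end RatPoly

section EigenfunctionApproximation

/-- An approximation of the dimension of `contFractSet 4`. -/
def dimApprox : ℚ := 788945557483154 / 10 ^ 15

/-- Rounding down to a multiple of `10 ^ (-18)`. -/
def roundDown (q : ℚ) : ℚ := ⌊q * 10 ^ 18⌋ / 10 ^ 18

/-- The distance from the point `1 / 2` to the pole of the branch with digit `i + 1`. -/
def branchNode (i : Fin 4) : ℚ := (i : ℕ) + 3 / 2

/-- The Taylor polynomial at `1 / 2`, with numerically determined coefficients, of an approximate
eigenfunction of the transfer operator. -/
def eigenPoly : RatPoly :=
  [1000000000000000000, -613025370951306522, 339073240539977847, -186762685735926720,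
    103888945386820706, -58333485444837520, 32979570207794923, -18735157895966085,
    10679804960683645, -6103695661310884, 3495543393491784, -2005299709598147, 1152084614460826,
    -662758037655552, 381708988360131, -220073518425375, 127004523455447, -73358343282360,
    42405836496568, -24531143711785, 14200356575642].map (· / 10 ^ 18)

/-- Approximate Taylor polynomial at `1 / 2` of the weight `(cfDigit i + x) ^ (-(2 * dimApprox))`;
the listed constant terms are the only transcendental data, the other coefficients being obtained
from the binomial series. -/
def weightPoly (i : Fin 4) : RatPoly :=
  RatPoly.rpowCoeffs roundDown (branchNode i) (2 * dimApprox) 40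
    (![527408551095710093, 235555905144308078, 138522355178653388, 93175509950208948] i / 10 ^ 18) 0

/-- Approximate Taylor polynomial at `1 / 2` of `(cfDigit i + x) ^ (20 - 2 * dimApprox)` times the
approximate eigenfunction at `1 / (cfDigit i + x)`. -/
def pulledBackPoly (i : Fin 4) : RatPoly :=
  (weightPoly i).mul (RatPoly.homogenize [1 - branchNode i / 2, -1 / 2] [branchNode i, 1] eigenPoly)

/-- Approximate Taylor polynomial at `1 / 2` of the summand with digit `i + 1` of the transfer
operator applied to the approximate eigenfunction. -/
def summandPoly (i : Fin 4) : RatPoly :=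
  (pulledBackPoly i).divLinearPow roundDown 38 (branchNode i) 20

set_option maxRecDepth 100000 in
theorem l1Norm_eulerDefect_weightPoly_le (i : Fin 4) :
    ((weightPoly i).eulerDefect (branchNode i) (2 * dimApprox)).l1Norm (1 / 2) ≤ 1 / 10 ^ 16 := by
  revert i
  decide +kernel

set_option maxRecDepth 100000 in
theorem abs_eval_weightPoly_zero_sub_one_le :
    |(weightPoly 0).eval (-(1 / 2) : ℚ) - 1| ≤ 1 / 10 ^ 17 := by
  decide +kernel

set_option maxRecDepth 100000 in
theorem abs_eval_weightPoly_succ_sub_le (i : Fin 3) :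
    |(weightPoly i.succ).eval (-(1 / 2) : ℚ) - (weightPoly i.castSucc).eval (1 / 2 : ℚ)| ≤
      1 / 10 ^ 18 := by
  revert i
  decide +kernel

set_option maxRecDepth 100000 in
theorem l1Norm_pulledBackPoly_sub_le (i : Fin 4) :
    ((pulledBackPoly i).sub ((summandPoly i).mul (RatPoly.pow [branchNode i, 1] 20))).l1Norm
      (1 / 3) ≤ 1 / 10 ^ 14 * (branchNode i - 1 / 3) ^ 20 := by
  revert i
  decide +kernel

set_option maxRecDepth 100000 in
theorem l1Norm_sum_summandPoly_sub_le :
    ((((summandPoly 0).add (summandPoly 1)).add ((summandPoly 2).add (summandPoly 3))).sub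
      eigenPoly).l1Norm (1 / 3) ≤ 1 / 10 ^ 14 := by
  decide +kernel

set_option maxRecDepth 100000 in
theorem l1Norm_eigenPoly_sub_one_le : (eigenPoly.sub [1]).l1Norm (1 / 3) ≤ 26 / 100 := by
  decide +kernel

/-- The quotient of the Taylor polynomial of a weight by that weight, in the coordinate
`h = x - 1 / 2`; it is certified to be nearly constant, then nearly `1`. -/
noncomputable def weightRatio (i : Fin 4) (h : ℝ) : ℝ :=
  (weightPoly i).eval h * (branchNode i + h) ^ ((2 * dimApprox : ℚ) : ℝ)

theorem abs_weightRatio_sub_le (i : Fin 4) {x y : ℝ} (hx : |x| ≤ 1 / 2) (hy : |y| ≤ 1 / 2) :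
    |weightRatio i x - weightRatio i y| ≤ 5 / 10 ^ 16 := by
  have hσ : 1 ≤ 2 * dimApprox := by norm_num [dimApprox]
  have hσ' : ((2 * dimApprox : ℚ) : ℝ) - 1 ∈ Set.Icc 0 1 := by norm_num [dimApprox]
  have hρ : 1 / 2 < branchNode i := by
    have : (0 : ℚ) ≤ (i : ℕ) := Nat.cast_nonneg _
    rw [branchNode]
    linarith
  have hnode : (branchNode i + (1 / 2 : ℚ) : ℝ) ∈ Set.Icc 1 5 := by
    fin_cases i <;> norm_num [branchNode]
  have hpow : (branchNode i + (1 / 2 : ℚ) : ℝ) ^ (((2 * dimApprox : ℚ) : ℝ) - 1) ≤ 5 :=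
    (Real.rpow_le_self_of_one_le hnode.1 hσ'.2).trans hnode.2
  have hxy : |x - y| ≤ 1 := by
    linarith [abs_sub x y]
  refine (RatPoly.abs_eval_mul_rpow_sub_le hσ hρ (l1Norm_eulerDefect_weightPoly_le i)
    (by simpa using hx) (by simpa using hy)).trans ?_
  push_cast at hpow ⊢
  calc _ ≤ (5 : ℝ) * (1 / 10 ^ 16) * 1 := by gcongr
    _ = 5 / 10 ^ 16 := by ring

theorem abs_weightRatio_zero_sub_one_le : |weightRatio 0 (-(1 / 2)) - 1| ≤ 1 / 10 ^ 17 := by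
  have hval : (((weightPoly 0).eval (-(1 / 2) : ℚ) : ℚ) : ℝ) = weightRatio 0 (-(1 / 2)) := by
    have hone : ((branchNode 0 : ℚ) : ℝ) + -(1 / 2) = 1 := by norm_num [branchNode]
    rw [weightRatio, hone, Real.one_rpow, mul_one, RatPoly.ratCast_eval]
    norm_num
  have hcert := abs_eval_weightPoly_zero_sub_one_le
  rw [← Rat.cast_le (K := ℝ)] at hcert
  push_cast at hcert
  rwa [hval] at hcert

theorem abs_weightRatio_succ_sub_le (i : Fin 3) :
    |weightRatio i.succ (-(1 / 2)) - weightRatio i.castSucc (1 / 2)| ≤ 2 / 10 ^ 17 := by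
  -- The denominators `branchNode i + h` of consecutive digits range over abutting intervals.
  have hleft : ((branchNode i.succ : ℚ) : ℝ) + -(1 / 2) = (i : ℕ) + 2 := by
    rw [branchNode, Fin.val_succ]; push_cast; ring
  have hright : ((branchNode i.castSucc : ℚ) : ℝ) + 1 / 2 = (i : ℕ) + 2 := by
    rw [branchNode, Fin.val_castSucc]; push_cast; ring
  have hcert : |(weightPoly i.succ).eval (-(1 / 2) : ℝ) - (weightPoly i.castSucc).eval (1 / 2 : ℝ)|
      ≤ 1 / 10 ^ 18 := by
    have h := abs_eval_weightPoly_succ_sub_le i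
    rw [← Rat.cast_le (K := ℝ)] at h
    simpa [RatPoly.ratCast_eval] using h
  have hi : ((i : ℕ) : ℝ) + 2 ≤ 4 := by fin_cases i <;> norm_num
  have hpow : ((i : ℕ) + 2 : ℝ) ^ ((2 * dimApprox : ℚ) : ℝ) ≤ 4 ^ (2 : ℝ) :=
    calc ((i : ℕ) + 2 : ℝ) ^ ((2 * dimApprox : ℚ) : ℝ)
        ≤ 4 ^ ((2 * dimApprox : ℚ) : ℝ) :=
          Real.rpow_le_rpow (by positivity) hi (by norm_num [dimApprox])
      _ ≤ 4 ^ (2 : ℝ) := Real.rpow_le_rpow_of_exponent_le (by norm_num) (by norm_num [dimApprox])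
  rw [weightRatio, weightRatio, hleft, hright, ← sub_mul, abs_mul,
    abs_of_nonneg (a := ((i : ℕ) + 2 : ℝ) ^ ((2 * dimApprox : ℚ) : ℝ)) (by positivity)]
  calc _ ≤ (1 / 10 ^ 18 : ℝ) * 4 ^ (2 : ℝ) := by gcongr
    _ ≤ 2 / 10 ^ 17 := by norm_num

theorem abs_weightRatio_neg_half_sub_one_le (i : Fin 4) :
    |weightRatio i (-(1 / 2)) - 1| ≤ ((i : ℕ) + 1) * (6 / 10 ^ 16) := by
  induction i using Fin.induction with
  | zero => exact abs_weightRatio_zero_sub_one_le.trans (by norm_num)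
  | succ i ih =>
    have hstep := abs_weightRatio_succ_sub_le i
    have hbranch := abs_weightRatio_sub_le i.castSucc (x := 1 / 2) (y := -(1 / 2))
      (by norm_num) (by norm_num)
    rw [Fin.val_castSucc] at ih
    rw [Fin.val_succ]
    push_cast
    rw [abs_le] at ih hstep hbranch ⊢
    constructor <;> linarith

theorem abs_weightRatio_sub_one_le (i : Fin 4) {h : ℝ} (hh : |h| ≤ 1 / 2) :
    |weightRatio i h - 1| ≤ 3 / 10 ^ 15 := by
  have hi : ((i : ℕ) : ℝ) + 1 ≤ 4 := by fin_cases i <;> norm_num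
  have hbranch := abs_weightRatio_sub_le i (y := -(1 / 2)) hh (by norm_num)
  have hleft := abs_weightRatio_neg_half_sub_one_le i
  rw [abs_le] at hbranch hleft ⊢
  constructor <;> linarith

theorem one_le_branchNode_add (i : Fin 4) {h : ℝ} (hh : |h| ≤ 1 / 2) : 1 ≤ branchNode i + h := by
  have : (0 : ℝ) ≤ (i : ℕ) := Nat.cast_nonneg _
  rw [branchNode]
  push_cast
  linarith [(abs_le.1 hh).1]

theorem abs_eval_weightPoly_sub_rpow_le (i : Fin 4) {h : ℝ} (hh : |h| ≤ 1 / 2) :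
    |(weightPoly i).eval h - (branchNode i + h) ^ (-(2 * (dimApprox : ℝ)))| ≤ 3 / 10 ^ 15 := by
  have hone := one_le_branchNode_add i hh
  have hpos : (0 : ℝ) < branchNode i + h := one_pos.trans_le hone
  have hweight : (branchNode i + h : ℝ) ^ (-(2 * (dimApprox : ℝ))) ≤ 1 :=
    Real.rpow_le_one_of_one_le_of_nonpos hone (by norm_num [dimApprox])
  have hfactor : (weightPoly i).eval h - (branchNode i + h) ^ (-(2 * (dimApprox : ℝ))) =
      (weightRatio i h - 1) * (branchNode i + h) ^ (-(2 * (dimApprox : ℝ))) := by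
    rw [weightRatio, sub_mul, one_mul, mul_assoc, ← Real.rpow_add hpos]
    push_cast
    rw [add_neg_cancel, Real.rpow_zero, mul_one]
  rw [hfactor, abs_mul, abs_of_nonneg (Real.rpow_nonneg hpos.le _)]
  exact (mul_le_of_le_one_right (abs_nonneg _) hweight).trans (abs_weightRatio_sub_one_le i hh)

theorem eval_pulledBackPoly (i : Fin 4) {h : ℝ} (hh : |h| ≤ 1 / 2) :
    (pulledBackPoly i).eval h = (branchNode i + h) ^ 20 *
      ((weightPoly i).eval h * eigenPoly.eval (1 / (branchNode i + h) - 1 / 2)) := by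
  have hne : (branchNode i + h : ℝ) ≠ 0 := (one_pos.trans_le (one_le_branchNode_add i hh)).ne'
  have hv : RatPoly.eval [branchNode i, 1] h = branchNode i + h := by
    rw [RatPoly.eval_linear, Rat.cast_one, one_mul]
  have hu : RatPoly.eval [1 - branchNode i / 2, -1 / 2] h / (branchNode i + h) =
      1 / (branchNode i + h) - 1 / 2 := by
    rw [RatPoly.eval_linear]
    push_cast
    field_simp
    ring
  have hhom := RatPoly.eval_homogenize_mul [1 - branchNode i / 2, -1 / 2] [branchNode i, 1]
    eigenPoly (x := h) (hv ▸ hne)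
  rw [hv, hu, show eigenPoly.length = 20 + 1 from rfl, pow_succ, mul_right_comm] at hhom
  rw [pulledBackPoly, RatPoly.eval_mul, mul_right_cancel₀ hne hhom]
  ring

theorem abs_eval_weightPoly_mul_sub_eval_summandPoly_le (i : Fin 4) {h : ℝ} (hh : |h| ≤ 1 / 3) :
    |(weightPoly i).eval h * eigenPoly.eval (1 / (branchNode i + h) - 1 / 2) -
      (summandPoly i).eval h| ≤ 1 / 10 ^ 14 := by
  have hh' : |h| ≤ 1 / 2 := hh.trans (by norm_num)
  have hpos : (0 : ℝ) < branchNode i + h := one_pos.trans_le (one_le_branchNode_add i hh')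
  have hcert := RatPoly.abs_eval_le_of_l1Norm_le (l1Norm_pulledBackPoly_sub_le i) (x := h)
    (by simpa using hh)
  rw [RatPoly.eval_sub, eval_pulledBackPoly i hh', RatPoly.eval_mul, RatPoly.eval_pow,
    RatPoly.eval_linear, Rat.cast_one, one_mul, mul_comm (RatPoly.eval (summandPoly i) h),
    ← mul_sub, abs_mul,
    abs_of_pos (pow_pos hpos 20)] at hcert
  have hnode : (0 : ℝ) ≤ branchNode i - 1 / 3 := by
    fin_cases i <;> norm_num [branchNode]
  refine le_of_mul_le_mul_left (hcert.trans ?_) (pow_pos hpos 20)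
  push_cast
  rw [mul_comm]
  gcongr
  linarith [(abs_le.1 hh).1]

/-- A polynomial approximation of the eigenfunction of the transfer operator of the digits
`1, …, 4` with exponent `dimApprox`. -/
noncomputable def eigenFun (x : ℝ) : ℝ := eigenPoly.eval (x - 1 / 2)

theorem abs_sub_half_le {x : ℝ} (hx : x ∈ coreInterval 4) : |x - 1 / 2| ≤ 1 / 3 := by
  norm_num [coreInterval] at hx
  exact abs_le.2 ⟨by linarith [hx.1], by linarith [hx.2]⟩

theorem abs_eigenFun_sub_one_le {x : ℝ} (hx : x ∈ coreInterval 4) :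
    |eigenFun x - 1| ≤ 26 / 100 := by
  have hcert := RatPoly.abs_eval_le_of_l1Norm_le l1Norm_eigenPoly_sub_one_le (x := x - 1 / 2)
    (by simpa using abs_sub_half_le hx)
  rw [RatPoly.eval_sub] at hcert
  push_cast at hcert
  simpa [eigenFun, RatPoly.eval] using hcert

theorem abs_rpow_mul_eigenFun_sub_eval_summandPoly_le (i : Fin 4) {x : ℝ}
    (hx : x ∈ coreInterval 4) :
    |(cfDigit i + x) ^ (-(2 * (dimApprox : ℝ))) * eigenFun (1 / (cfDigit i + x)) -
      (summandPoly i).eval (x - 1 / 2)| ≤ 2 / 10 ^ 14 := by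
  have hh := abs_sub_half_le hx
  have hnode : (branchNode i : ℝ) + (x - 1 / 2) = cfDigit i + x := by
    rw [branchNode, cfDigit]; push_cast; ring
  have hweight := abs_eval_weightPoly_sub_rpow_le i (hh.trans (by norm_num))
  have hsummand := abs_eval_weightPoly_mul_sub_eval_summandPoly_le i hh
  have hbranch := abs_eigenFun_sub_one_le (branch_mem_coreInterval_of_mem i hx)
  rw [hnode] at hweight hsummand
  rw [← eigenFun] at hsummand
  generalize eigenFun (1 / (cfDigit i + x)) = F at *
  generalize (cfDigit i + x) ^ (-(2 * (dimApprox : ℝ))) = A at *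
  have hF : |F| ≤ 2 := by
    rw [abs_le] at hbranch ⊢
    constructor <;> linarith
  calc |A * F - (summandPoly i).eval (x - 1 / 2)|
      = |((weightPoly i).eval (x - 1 / 2) * F - (summandPoly i).eval (x - 1 / 2)) -
          ((weightPoly i).eval (x - 1 / 2) - A) * F| := by ring_nf
    _ ≤ 1 / 10 ^ 14 + 3 / 10 ^ 15 * 2 := by
        refine (abs_sub _ _).trans ?_
        rw [abs_mul]
        gcongr
    _ ≤ 2 / 10 ^ 14 := by norm_num

theorem abs_transferOp_eigenFun_sub_le {x : ℝ} (hx : x ∈ coreInterval 4) :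
    |transferOp 4 dimApprox eigenFun x - eigenFun x| ≤ 1 / 10 ^ 13 := by
  have hsum : |∑ i, (summandPoly i).eval (x - 1 / 2) - eigenFun x| ≤ 1 / 10 ^ 14 := by
    have hcert := RatPoly.abs_eval_le_of_l1Norm_le l1Norm_sum_summandPoly_sub_le (x := x - 1 / 2)
      (by simpa using abs_sub_half_le hx)
    simp only [RatPoly.eval_sub, RatPoly.eval_add] at hcert
    rw [Fin.sum_univ_four, eigenFun, add_assoc (_ + _)]
    push_cast at hcert
    exact hcert
  calc |transferOp 4 dimApprox eigenFun x - eigenFun x|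
      ≤ |transferOp 4 dimApprox eigenFun x - ∑ i, (summandPoly i).eval (x - 1 / 2)| +
          |∑ i, (summandPoly i).eval (x - 1 / 2) - eigenFun x| := abs_sub_le _ _ _
    _ ≤ ∑ _i : Fin 4, 2 / 10 ^ 14 + 1 / 10 ^ 14 := by
        rw [transferOp, ← Finset.sum_sub_distrib]
        gcongr
        exact (Finset.abs_sum_le_sum_abs _ _).trans (Finset.sum_le_sum fun i _ =>
          abs_rpow_mul_eigenFun_sub_eval_summandPoly_le i hx)
    _ ≤ 1 / 10 ^ 13 := by norm_num

end EigenfunctionApproximation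

theorem dimH_contFractSet_four_le :
    dimH (contFractSet 4) ≤ ENNReal.ofReal (0.788945557483 + 1 / 10 ^ 12) := by
  have hlower {x : ℝ} (hx : x ∈ coreInterval 4) : 74 / 100 ≤ eigenFun x := by
    linarith [(abs_le.1 (abs_eigenFun_sub_one_le hx)).1]
  have hdim := dimH_contFractSet_le_add (m := 4) (s := dimApprox) (δ := 846 / 10 ^ 15)
    (by norm_num [dimApprox]) (by norm_num) (by norm_num) (fun x hx => hlower hx) fun x hx => by
      have herror := (abs_le.1 (abs_transferOp_eigenFun_sub_le hx)).2
      push_cast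
      linarith [hlower hx]
  convert hdim using 2
  norm_num [dimApprox]

theorem le_dimH_contFractSet_four :
    ENNReal.ofReal (0.788945557483 - 1 / 10 ^ 12) ≤ dimH (contFractSet 4) := by
  have hbounds {x : ℝ} (hx : x ∈ coreInterval 4) := abs_le.1 (abs_eigenFun_sub_one_le hx)
  have hdim := sub_le_dimH_contFractSet (m := 4) (s := dimApprox) (δ := 1154 / 10 ^ 15)
    (c := 74 / 100) (M := 126 / 100) (f := eigenFun)
    (by norm_num) (by norm_num [dimApprox]) (by norm_num)
    (fun x hx => by linarith [(hbounds hx).1]) (fun x hx => by linarith [(hbounds hx).2])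
    fun x hx => by
      have herror := (abs_le.1 (abs_transferOp_eigenFun_sub_le hx)).1
      push_cast
      linarith [(hbounds hx).1]
  convert hdim using 2
  norm_num [dimApprox]

theorem mainTheorem7 :
    dimH (contFractSet 4) ≠ ⊤ ∧
    (dimH (contFractSet 4)).toReal ∈
      Set.Icc ((0.788945557483 : ℝ) - 1 / 10 ^ 12) ((0.788945557483 : ℝ) + 1 / 10 ^ 12) ∧
    (Real.sqrt 19 - 2) / 3 < (dimH (contFractSet 4)).toReal := by
  have htop : dimH (contFractSet 4) ≠ ⊤ :=
    ne_top_of_le_ne_top ENNReal.ofReal_ne_top dimH_contFractSet_four_le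
  have hupper := ENNReal.toReal_le_of_le_ofReal (by norm_num) dimH_contFractSet_four_le
  have hlower := (ENNReal.ofReal_le_iff_le_toReal htop).1 le_dimH_contFractSet_four
  have hsqrt : Real.sqrt 19 < 4.36 := (Real.sqrt_lt' (by norm_num)).2 (by norm_num)
  exact ⟨htop, ⟨hlower, hupper⟩, lt_of_lt_of_le (by linarith) hlower⟩
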